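/- **Setting.** Let $\mathbb K\in\{\mathbb R,\mathbb C\}$, let $\Omega\subset\mathbb R^d$ be open, and let $V=H^m_0(\Omega;\mathbb K^r)$ be the closure of $C_c^\infty(\Omega;\mathbb K^r)$ in the $H^m$-norm. Let $\mathcal L$ be the linear partial differential operator given by the sesquilinear form $$a(u,v)=\sum_{|s|,|t|\le m}\int_\Omega A_{st}\,\partial_t u\cdot\overline{\partial_s v}\,dx,\qquad A_{st}\in L^\infty(\Omega;\mathbb K^{r\times r}).$$ Assume that $\mathcal L$ is self-adjoint ($a(u,v)=\overline{a(v,u)}$ on $V$) and positive definite ($a(v,v)\ge\alpha\|v\|_{H^m}^2$ on $V$ for some $\alpha>0$), and that $V$ is compactly embedded in $L^2(\Omega;\mathbb K^r)$. Write $\|v\|_a^2=a(v,v)$ and $(\cdot,\cdot)$ for the $L^2$ product. Let $\omega_1,\dots,\omega_{N_c}$ ($N_c\ge1$) be open sets with $\Omega=\bigcup_i\omega_i$, and let $\chi_1,\dots,\chi_{N_c}$ be real functions, measurable on $\mathbb R^d$ and bounded on $\Omega$, with $\sum_i\chi_i=1$ on $\Omega$ and $\operatorname{supp}\chi_i\subset\overline{\omega_i}$.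 Put $V(\omega_i)=\{v\in V: v=0\text{ a.e. outside }\omega_i\}$, and let $\mathcal L_i$ be the restriction of $\mathcal L$ to $V(\omega_i)$: for $w\in V(\omega_i)$ and $g\in L^2(\Omega)$, $\mathcal L_iw=g$ means $a(w,v)=(g,v)$ for all $v\in V(\omega_i)$. Let $(\lambda_i^j,\phi_i^j)_{j\ge1}$, with $\lambda_i^1\ge\lambda_i^2\ge\cdots$, enumerate all eigenpairs of $\mathcal L_i^{-1}$ with multiplicity, the eigenfunctions being orthonormal in $L^2$. *The multiscale space.* Let $L_i\ge1$, and let $\phi_i^{1,0},\dots,\phi_i^{L_i,0}\in V(\omega_i)$ be initial functions whose projections $P_i\phi_i^{k,0}=\sum_{j\le L_i}(\phi_i^{k,0},\phi_i^j)\phi_i^j$, $k=1,\dots,L_i$, are linearly independent. For $n\ge0$ let $\phi_i^{k,n+1}\in V(\omega_i)$ solve, with multipliers $\mu_j=\mu_{i,k}^{j,n+1}\in\mathbb K$, $$a(\phi_i^{k,n+1},v)+\sum_{j=1}^{L_i}\mu_j(\phi_i^{j,n},v)=0\ \ \forall v\in V(\omega_i),\qquad(\phi_i^{j,n},\phi_i^{k,n+1})=\delta_{jk},\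 \ 1\le j\le L_i.$$ Put $V_S^n=\sum_{i=1}^{N_c}\operatorname{span}\{\phi_i^{k,n}:1\le k\le L_i\}$. **Theorem (convergence of the LSSI method).** There are a constant $C\ge0$ and a sequence $\varepsilon_n\ge0$ with $\varepsilon_n\to0$, both independent of $f$ and $u$, and $C$ independent of $n$, such that the following holds. Let $f\in L^2(\Omega)$, let $u\in V$ satisfy $\mathcal Lu=f$, that is, $a(u,v)=(f,v)$ for all $v\in V$, and suppose that for every $i$, $\chi_iu\in V(\omega_i)$ and $\mathcal L\chi_iu\in L^2(\Omega)$ in the sense that $\mathcal L_i(\chi_iu)=g_i$ with some $g_i\in L^2(\Omega)$; write $\mathcal L\chi_iu$ for $g_i$. Then for every $n\ge0$ the Galerkin solution $u_S\in V_S^n$, that is, $a(u_S,v)=(f,v)$ for all $v\in V_S^n$, obeys $$\|u-u_S\|_a\le\sqrt{\lambda^{L+1}}\sum_{i=1}^{N_c}\|\mathcal L\chi_iu\|_{L^2(\Omega)}+C\Big(\max_i\frac{\lambda_i^{L_i+1}}{\lambda_i^{L_i}}+\varepsilon_n\Big)^n\|u\|_{L^2(\Omega)},\qquad\lambda^{L+1}:=\max_i\lambda_i^{L_i+1}.$$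 -/

import Mathlib

open MeasureTheory Filter Topology

namespace LSSI

/-- The physical space `ℝ^d`. -/
abbrev Pt (d : ℕ) : Type := EuclideanSpace ℝ (Fin d)

/-- The values of the unknown: `𝕜^r` (`r = 1` for scalar equations, `r = d` for elasticity). -/
abbrev Val (𝕜 : Type*) [RCLike 𝕜] (r : ℕ) : Type _ := EuclideanSpace 𝕜 (Fin r)

/-- `L²(Ω; 𝕜^r)`. -/
abbrev L2 (𝕜 : Type*) [RCLike 𝕜] (r : ℕ) {d : ℕ} (Ω : Set (Pt d)) : Type _ :=
  Lp (Val 𝕜 r) 2 (volume.restrict Ω)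

/-- Names `s = (s₁, …, s_k)`, `k ≤ m`, `s_l ∈ {1, …, d}`, of the partial derivatives
`∂_{s₁} ⋯ ∂_{s_k}` of order at most `m`. -/
abbrev DIdx (d m : ℕ) : Type := (k : Fin (m + 1)) × (Fin (k : ℕ) → Fin d)

/-- The name of the derivative of order zero. -/
def DIdx.zero (d m : ℕ) : DIdx d m := ⟨0, fun l => Fin.elim0 l⟩

/-- The classical partial derivative `∂_{s₁} ⋯ ∂_{s_k} φ`. -/
noncomputable def partialDeriv {𝕜 : Type*} [RCLike 𝕜] {r d m : ℕ} (s : DIdx d m)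
    (φ : Pt d → Val 𝕜 r) (x : Pt d) : Val 𝕜 r :=
  iteratedFDeriv ℝ (s.1 : ℕ) φ x (fun l => EuclideanSpace.single (s.2 l) (1 : ℝ))

/-- Families of `L²` functions indexed by the partial derivatives of order at most `m`,
with the norm `(∑_s ‖u_s‖²)^{1/2}`. -/
abbrev Jet (𝕜 : Type*) [RCLike 𝕜] (r m : ℕ) {d : ℕ} (Ω : Set (Pt d)) : Type _ :=
  PiLp 2 (fun _ : DIdx d m => L2 𝕜 r Ω)

/-- The families `(∂_s φ)_s` with `φ ∈ C_c^∞(Ω; 𝕜^r)`. -/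
def testJets (𝕜 : Type*) [RCLike 𝕜] (r m : ℕ) {d : ℕ} (Ω : Set (Pt d)) :
    Set (Jet 𝕜 r m Ω) :=
  {J | ∃ φ : Pt d → Val 𝕜 r, ContDiff ℝ (⊤ : ℕ∞) φ ∧ HasCompactSupport φ ∧ tsupport φ ⊆ Ω ∧
    ∀ s, (J s : Pt d → Val 𝕜 r) =ᵐ[volume.restrict Ω] partialDeriv s φ}

/-- The Sobolev space `V = H^m_0(Ω; 𝕜^r)`, the closure of `C_c^∞(Ω; 𝕜^r)` in the `H^m` norm.
A function `u` of this space is represented by the family of its weak derivatives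
`(∂_s u)_s`; the component of index `DIdx.zero` is `u` itself, and it determines the others. -/
noncomputable def sobolevZero (𝕜 : Type*) [RCLike 𝕜] (r m : ℕ) {d : ℕ} (Ω : Set (Pt d)) :
    Submodule 𝕜 (Jet 𝕜 r m Ω) :=
  (Submodule.span 𝕜 (testJets 𝕜 r m Ω)).topologicalClosure

/-- `V = H^m_0(Ω; 𝕜^r)` as a type. -/
abbrev Sob (𝕜 : Type*) [RCLike 𝕜] (r m : ℕ) {d : ℕ} (Ω : Set (Pt d)) : Type _ :=
  ↥(sobolevZero 𝕜 r m Ω)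

section

variable {𝕜 : Type*} [RCLike 𝕜] {r m d : ℕ} {Ω : Set (Pt d)}

/-- The weak derivative `∂_s u ∈ L²(Ω; 𝕜^r)` of `u ∈ V`. -/
def weakDeriv (s : DIdx d m) (u : Sob 𝕜 r m Ω) : L2 𝕜 r Ω := (u : Jet 𝕜 r m Ω) s

/-- The embedding `V → L²(Ω; 𝕜^r)`. -/
def toL2 (u : Sob 𝕜 r m Ω) : L2 𝕜 r Ω := weakDeriv (DIdx.zero d m) u

/-- The `L²` product `(f, v) = ∫_Ω f · v̄`, linear in `f`. -/
noncomputable def prodL2 (f v : L2 𝕜 r Ω) : 𝕜 := inner 𝕜 v f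

/-- The coefficients `A_{st}` of a differential operator
`ℒ u = ∑_{s,t} (-1)^{|s|} ∂_s (A_{st} ∂_t u)`; each `A_{st}(x)` is a linear map of `𝕜^r`. -/
abbrev Coeff (𝕜 : Type*) [RCLike 𝕜] (r m d : ℕ) : Type _ :=
  DIdx d m → DIdx d m → Pt d → (Val 𝕜 r →L[𝕜] Val 𝕜 r)

/-- The coefficients are measurable and essentially bounded on `Ω`. -/
def BoundedCoeff (Ω : Set (Pt d)) (A : Coeff 𝕜 r m d) : Prop :=
  ∀ s t, AEStronglyMeasurable (A s t) (volume.restrict Ω) ∧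
    ∃ M : ℝ, ∀ᵐ x ∂(volume.restrict Ω), ‖A s t x‖ ≤ M

/-- The sesquilinear form `a(u, v) = ∑_{s,t} ∫_Ω A_{st} ∂_t u · conj(∂_s v)` of the operator,
linear in `u` and conjugate linear in `v`. -/
noncomputable def form (A : Coeff 𝕜 r m d) (u v : Sob 𝕜 r m Ω) : 𝕜 :=
  ∑ s, ∑ t, ∫ x in Ω, inner 𝕜 (weakDeriv s v x) (A s t x (weakDeriv t u x))

/-- The operator is self-adjoint. -/
def SelfAdjointForm (Ω : Set (Pt d)) (A : Coeff 𝕜 r m d) : Prop :=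
  ∀ u v : Sob 𝕜 r m Ω, form A u v = (starRingEnd 𝕜) (form A v u)

/-- The operator is positive definite: `a(v, v) ≥ α ‖v‖²_{H^m}` with some `α > 0`. -/
def CoerciveForm (Ω : Set (Pt d)) (A : Coeff 𝕜 r m d) : Prop :=
  ∃ α : ℝ, 0 < α ∧ ∀ v : Sob 𝕜 r m Ω, α * ‖v‖ ^ 2 ≤ RCLike.re (form A v v)

/-- The energy norm `‖u‖_a = a(u, u)^{1/2}`. -/
noncomputable def energyNorm (A : Coeff 𝕜 r m d) (u : Sob 𝕜 r m Ω) : ℝ :=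
  Real.sqrt (RCLike.re (form A u u))

/-- `w ∈ U` and `a(w, v) = (g, v)` for all `v ∈ U`. For `U = V` this is the weak form of
`ℒ w = g`; for `U = V(ω)` it says `ℒ_ω w = g`, that is `w = ℒ_ω⁻¹ g`; for a finite-dimensional
`U` it says that `w` is the Galerkin solution in `U` for the right-hand side `g`. -/
def Solves (A : Coeff 𝕜 r m d) (U : Submodule 𝕜 (Sob 𝕜 r m Ω)) (w : Sob 𝕜 r m Ω)
    (g : L2 𝕜 r Ω) : Prop :=
  w ∈ U ∧ ∀ v ∈ U, form A w v = prodL2 g (toL2 v)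

/-- The local space `V(ω) = {v ∈ V | v = 0 a.e. outside ω}`. -/
noncomputable def localSpace (𝕜 : Type*) [RCLike 𝕜] (r m : ℕ) (Ω ω : Set (Pt d)) :
    Submodule 𝕜 (Sob 𝕜 r m Ω) where
  carrier := {v | ∀ᵐ x ∂(volume.restrict Ω), x ∉ ω → toL2 v x = 0}
  zero_mem' := by
    have h : toL2 (0 : Sob 𝕜 r m Ω) = 0 := rfl
    simp only [Set.mem_ofPred_eq, h]
    filter_upwards [Lp.coeFn_zero (Val 𝕜 r) 2 (volume.restrict Ω)] with x hx _
    simpa using hx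
  add_mem' := by
    intro u v hu hv
    have h : toL2 (u + v) = toL2 u + toL2 v := rfl
    simp only [Set.mem_ofPred_eq, h] at hu hv ⊢
    filter_upwards [Lp.coeFn_add (toL2 u) (toL2 v), hu, hv] with x hx h1 h2 hω
    rw [hx, Pi.add_apply, h1 hω, h2 hω, add_zero]
  smul_mem' := by
    intro c u hu
    have h : toL2 (c • u) = c • toL2 u := rfl
    simp only [Set.mem_ofPred_eq, h] at hu ⊢
    filter_upwards [Lp.coeFn_smul c (toL2 u), hu] with x hx h1 hω
    rw [hx, Pi.smul_apply, h1 hω, smul_zero]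

/-- `(lam j, φ j)`, `j = 0, 1, 2, …`, enumerates all eigenpairs of the inverse `ℒ_U⁻¹` of the
operator restricted to `U`, with multiplicity and in nonincreasing order; the eigenfunctions
are orthonormal in `L²`. -/
structure IsEigensystem (A : Coeff 𝕜 r m d) (U : Submodule 𝕜 (Sob 𝕜 r m Ω))
    (lam : ℕ → ℝ) (φ : ℕ → Sob 𝕜 r m Ω) : Prop where
  mem : ∀ j, φ j ∈ U
  orthonormal : Orthonormal 𝕜 (fun j => toL2 (φ j))
  eigen : ∀ j, Solves A U ((lam j : 𝕜) • φ j) (toL2 (φ j))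
  antitone : Antitone lam
  /-- No eigenfunction is missing. -/
  exhaust : ∀ (μ : ℝ) (ψ : Sob 𝕜 r m Ω), ψ ∈ U → Solves A U ((μ : 𝕜) • ψ) (toL2 ψ) →
    (∀ j, prodL2 (toL2 ψ) (toL2 (φ j)) = 0) → ψ = 0

/-- The spectral projector `P v = ∑_{j < ℓ} (v, φ_j) φ_j` onto the span of the first `ℓ`
eigenfunctions. -/
noncomputable def spectralProj (φ : ℕ → Sob 𝕜 r m Ω) (ℓ : ℕ) (v : Sob 𝕜 r m Ω) :
    Sob 𝕜 r m Ω :=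
  ∑ j ∈ Finset.range ℓ, prodL2 (toL2 v) (toL2 (φ j)) • φ j

/-- One step of the subspace iteration in `U`: each new function `b' k ∈ U` solves, with some
multipliers `μ`, the saddle point problem
`a(b'_k, v) + ∑_j μ_j (b_j, v) = 0` for all `v ∈ U`, `(b_j, b'_k) = δ_{jk}` for all `j`. -/
def IterationStep (A : Coeff 𝕜 r m d) (U : Submodule 𝕜 (Sob 𝕜 r m Ω)) {ℓ : ℕ}
    (b b' : Fin ℓ → Sob 𝕜 r m Ω) : Prop :=
  ∀ k, b' k ∈ U ∧ ∃ μ : Fin ℓ → 𝕜,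
    (∀ v ∈ U, form A (b' k) v + ∑ j, μ j * prodL2 (toL2 (b j)) (toL2 v) = 0) ∧
    ∀ j, prodL2 (toL2 (b j)) (toL2 (b' k)) = if j = k then 1 else 0

/-- The multiscale space `V_S^n = ∑_i span {φ_i^{k,n} | k}`, where `b i n k = φ_i^{k,n}`. -/
noncomputable def multiscaleSpace {N : ℕ} {L : Fin N → ℕ}
    (b : (i : Fin N) → ℕ → Fin (L i) → Sob 𝕜 r m Ω) (n : ℕ) : Submodule 𝕜 (Sob 𝕜 r m Ω) :=
  ⨆ i, Submodule.span 𝕜 (Set.range (b i n))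

/-- A bounded partition of unity on `Ω` subordinate to the cover `ω`. -/
structure IsPartition (Ω : Set (Pt d)) {N : ℕ} (ω : Fin N → Set (Pt d))
    (χ : Fin N → Pt d → ℝ) : Prop where
  measurable : ∀ i, Measurable (χ i)
  bounded : ∀ i, ∃ M : ℝ, ∀ x ∈ Ω, |χ i x| ≤ M
  support : ∀ i, tsupport (χ i) ⊆ closure (ω i)
  sum_eq_one : ∀ x ∈ Ω, ∑ i, χ i x = 1

end

end LSSI

/-! By Céa's lemma (`galerkin_norm_le`) it suffices to exhibit one element of `V_S^n` close to `u`.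
Since `u = ∑ χ_i u` holds in `V`, the L² embedding being injective, the task splits into one
approximation problem per `ω_i`.

Write `ℓ = L_i`, and call tail the elements of `V(ω_i)` that are L²-orthogonal to the first `ℓ`
eigenfunctions. On the tail `‖v‖²_{L²} ≤ λ^{ℓ+1} ‖v‖_a²`: by compactness the best constant is
governed by eigenvalues, and one above `λ^{ℓ+1}` would have an eigenfunction missing from the list
(`norm_sq_le_on_tailSpace`). Hence truncating the eigenexpansion of `χ_i u = ℒ_i⁻¹ g_i` costs at
most `√λ^{ℓ+1} ‖g_i‖`.

The saddle point steps are inverse subspace iteration: the multipliers only select a basis, and the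
new span contains `ℒ_i⁻¹` of the old one (`exists_varSolves_mem_span`). Nondegeneracy gives an `s`
in the initial span with `s - φ_j` in the tail. The map `λ_j⁻¹ ℒ_i⁻¹` fixes `φ_j` and contracts the
tail by `λ^{ℓ+1}/λ^j ≤ λ^{ℓ+1}/λ^ℓ`, so every `φ_j` with `j ≤ ℓ` is approximated at a geometric
rate. Replacing the `φ_j` in the truncated expansion by these approximants produces the second error
term, with `ε_n = 0`. -/

namespace LSSI

/-! ### The energy Hilbert space and compact self-adjoint operators on it. -/

section Hilbert

variable {𝕜 : Type*} [RCLike 𝕜]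

/-- A positive definite Hermitian form on a vector space is the inner product of some inner
product structure. -/
theorem exists_linearEquiv_inner_eq_form.{u} {V : Type u} [iV : AddCommGroup V] [iM : Module 𝕜 V]
    (a : V → V → 𝕜)
    (hadd : ∀ u v w, a (u + v) w = a u w + a v w) (hsmul : ∀ (c : 𝕜) u w, a (c • u) w = c * a u w)
    (hsymm : ∀ u v, a u v = (starRingEnd 𝕜) (a v u))
    (hnonneg : ∀ v, 0 ≤ RCLike.re (a v v)) (hdef : ∀ v, a v v = 0 → v = 0) :
    ∃ (H : Type u) (_ : NormedAddCommGroup H) (_ : InnerProductSpace 𝕜 H) (e : V ≃ₗ[𝕜] H),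
      ∀ u v, inner 𝕜 (e v) (e u) = a u v := by
  -- `V` carries no norm here, so the energy norm can live on `V` itself. The existential `H` keeps
  -- it apart from the Sobolev norm in applications. The arguments are swapped because `a` is linear
  -- in the first one.
  let core : InnerProductSpace.Core 𝕜 V :=
    { inner := fun v u => a u v
      conj_inner_symm := fun x y => (hsymm y x).symm
      re_inner_nonneg := fun x => hnonneg x
      add_left := fun x y z => by
        rw [hsymm z (x + y), hadd, map_add, ← hsymm, ← hsymm]
      smul_left := fun x y c => by
        rw [hsymm y (c • x), hsmul, map_mul, ← hsymm]
      definite := fun x hx => hdef x hx }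
  let i1 : NormedAddCommGroup V := core.toNormedAddCommGroup
  let i2 : InnerProductSpace 𝕜 V := InnerProductSpace.ofCore core.toCore
  exact ⟨V, i1, i2, LinearEquiv.refl 𝕜 V, fun u v => rfl⟩

/-- A bounded coercive Hermitian form on a complete space is the inner product of a Hilbert space
with the same underlying topological vector space. -/
theorem exists_continuousLinearEquiv_inner_eq_form.{u} {V : Type u} [NormedAddCommGroup V]
    [NormedSpace 𝕜 V] [CompleteSpace V] (a : V → V → 𝕜)
    (hadd : ∀ u v w, a (u + v) w = a u w + a v w) (hsmul : ∀ (c : 𝕜) u w, a (c • u) w = c * a u w)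
    (hsymm : ∀ u v, a u v = (starRingEnd 𝕜) (a v u))
    {M α : ℝ} (hbound : ∀ v, ‖a v v‖ ≤ M * ‖v‖ ^ 2)
    (hα : 0 < α) (hcoer : ∀ v, α * ‖v‖ ^ 2 ≤ RCLike.re (a v v)) :
    ∃ (H : Type u) (_ : NormedAddCommGroup H) (_ : InnerProductSpace 𝕜 H) (_ : CompleteSpace H)
      (e : V ≃L[𝕜] H), ∀ u v, inner 𝕜 (e v) (e u) = a u v := by
  obtain ⟨H, iH, iI, e, he⟩ := exists_linearEquiv_inner_eq_form a hadd hsmul hsymm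
    (fun v => le_trans (by positivity) (hcoer v)) (fun v hv => by
      have h := hcoer v
      rw [hv, map_zero] at h
      have : ‖v‖ ^ 2 ≤ 0 := by nlinarith [sq_nonneg ‖v‖]
      simpa using this)
  have hn : ∀ v, ‖e v‖ ^ 2 = RCLike.re (a v v) := fun v => by
    rw [← he, inner_self_eq_norm_sq]
  have hup : ∀ v, ‖e v‖ ≤ Real.sqrt M * ‖v‖ := fun v => by
    -- The sign of `M` is not given; a negative `M` forces `v = 0`.
    rcases le_or_gt 0 M with hM | hM
    · refine abs_le_of_sq_le_sq' ?_ (by positivity) |>.2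
      rw [mul_pow, Real.sq_sqrt hM, hn]
      exact (RCLike.re_le_norm _).trans (hbound v)
    · have h := hbound v
      have h0 : ‖v‖ ^ 2 ≤ 0 := by nlinarith [norm_nonneg (a v v), sq_nonneg ‖v‖]
      have : v = 0 := by simpa using h0
      simp [this]
  have hlow : ∀ x, ‖e.symm x‖ ≤ (Real.sqrt α)⁻¹ * ‖x‖ := fun x => by
    have h := hcoer (e.symm x)
    rw [← hn, e.apply_symm_apply] at h
    have hs : 0 < Real.sqrt α := Real.sqrt_pos.2 hα
    rw [inv_mul_eq_div, le_div_iff₀ hs]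
    refine abs_le_of_sq_le_sq' ?_ (by positivity) |>.2
    rw [mul_pow, Real.sq_sqrt hα.le]
    linarith
  let E : V ≃L[𝕜] H := e.toContinuousLinearEquivOfBounds _ _ hup hlow
  exact ⟨H, iH, iI,
    (completeSpace_congr (e := E.toEquiv) E.isUniformEmbedding).1 inferInstance, E, he⟩

/-- If `J† J` on the closed subspace `W` has no eigenvalue above `c`, then `J† J ≤ c` on `W`. -/
theorem norm_sq_le_of_forall_eigenvalue_le {H G : Type*} [NormedAddCommGroup H]
    [InnerProductSpace 𝕜 H] [NormedAddCommGroup G] [InnerProductSpace 𝕜 G] [CompleteSpace G]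
    (J : H →L[𝕜] G) (hJ : IsCompactOperator J) (W : Submodule 𝕜 H) [CompleteSpace W]
    {c : ℝ} (hc : 0 ≤ c)
    (h : ∀ μ : ℝ, c < μ → ∀ v ∈ W, (∀ x ∈ W, inner 𝕜 (J x) (J v) = (μ : 𝕜) * inner 𝕜 x v) → v = 0)
    {v : H} (hv : v ∈ W) : ‖J v‖ ^ 2 ≤ c * ‖v‖ ^ 2 := by
  let JW : W →L[𝕜] G := J ∘L W.subtypeL
  let T : W →L[𝕜] W := ContinuousLinearMap.adjoint JW ∘L JW
  have hTi : ∀ x y : W, inner 𝕜 x (T y) = inner 𝕜 (J x) (J y) := fun x y => by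
    simp only [T, ContinuousLinearMap.comp_apply, ContinuousLinearMap.adjoint_inner_right]
    rfl
  have hTc : IsCompactOperator T := 
    (hJ.comp_clm W.subtypeL).clm_comp (ContinuousLinearMap.adjoint JW)
  have hTs : IsSelfAdjoint T := ContinuousLinearMap.IsPositive.isSelfAdjoint
    (ContinuousLinearMap.isPositive_adjoint_comp_self JW)
  -- Self-adjointness equates the norm with the spectral radius; compactness makes every nonzero
  -- spectral value an eigenvalue.
  have hnorm : ‖T‖ ≤ c := by
    have hr := T.spectralRadius_eq_nnnorm hTs
    have hle : spectralRadius 𝕜 T ≤ ENNReal.ofReal c := by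
      refine iSup₂_le fun ν hν => ?_
      rcases eq_or_ne ν 0 with rfl | hν0
      · simp
      · obtain ⟨y, hy⟩ := ((hTc.hasEigenvalue_iff_mem_spectrum hν0).2 hν).exists_hasEigenvector
        have hy0 : y ≠ 0 := hy.2
        have hTy : T y = ν • y := hy.apply_eq_smul
        have h1 : ∀ x : W, inner 𝕜 (J x) (J y) = ν * inner 𝕜 (x : H) (y : H) := fun x => by
          rw [← hTi, hTy, inner_smul_right]; rfl
        have hyn : 0 < ‖(y : H)‖ ^ 2 := by
          have : (y : H) ≠ 0 := fun h => hy0 (Subtype.ext h)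
          positivity
        -- An eigenvalue is its own Rayleigh quotient, hence real and nonnegative, so the hypothesis
        -- on real `μ` applies.
        have hreal : ν = ((‖J y‖ ^ 2 / ‖(y : H)‖ ^ 2 : ℝ) : 𝕜) := by
          have h2 := h1 y
          rw [inner_self_eq_norm_sq_to_K, inner_self_eq_norm_sq_to_K] at h2
          have h3 : ((‖(y : H)‖ : 𝕜)) ^ 2 ≠ 0 := by exact_mod_cast hyn.ne'
          push_cast
          rw [h2, mul_div_cancel_right₀ _ h3]
        set μ : ℝ := ‖J y‖ ^ 2 / ‖(y : H)‖ ^ 2 with hμ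
        have hμ0 : 0 ≤ μ := by positivity
        have hμc : μ ≤ c := by
          by_contra! hlt
          refine hy0 (Subtype.ext (h μ hlt y y.2 fun x hx => ?_))
          rw [← hreal]
          exact h1 ⟨x, hx⟩
        rw [← enorm_eq_nnnorm, ← ofReal_norm, hreal, RCLike.norm_ofReal, abs_of_nonneg hμ0]
        exact ENNReal.ofReal_le_ofReal hμc
    rw [hr] at hle
    have := ENNReal.toReal_mono ENNReal.ofReal_ne_top hle
    rwa [ENNReal.toReal_ofReal hc] at this
  have h1 : ‖J v‖ ^ 2 = RCLike.re (inner 𝕜 (⟨v, hv⟩ : W) (T ⟨v, hv⟩)) := by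
    rw [hTi, inner_self_eq_norm_sq]
  calc ‖J v‖ ^ 2 ≤ ‖(⟨v, hv⟩ : W)‖ * ‖T ⟨v, hv⟩‖ := h1 ▸ re_inner_le_norm _ _
    _ ≤ ‖(⟨v, hv⟩ : W)‖ * (‖T‖ * ‖(⟨v, hv⟩ : W)‖) := by gcongr; exact T.le_opNorm _
    _ ≤ ‖(⟨v, hv⟩ : W)‖ * (c * ‖(⟨v, hv⟩ : W)‖) := by gcongr
    _ = c * ‖v‖ ^ 2 := by rw [Submodule.coe_norm]; ring

/-- The preceding bound for a space with an equivalent Hilbert norm. -/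
theorem norm_sq_le_of_forall_eigenvalue_le' {V H G : Type*} [NormedAddCommGroup V]
    [NormedSpace 𝕜 V] [NormedAddCommGroup H] [InnerProductSpace 𝕜 H] [CompleteSpace H]
    [NormedAddCommGroup G] [InnerProductSpace 𝕜 G] [CompleteSpace G] (e : V ≃L[𝕜] H)
    (J : V →L[𝕜] G) (hJ : IsCompactOperator J) (W : Submodule 𝕜 V) (hW : IsClosed (W : Set V))
    {c : ℝ} (hc : 0 ≤ c)
    (h : ∀ μ : ℝ, c < μ → ∀ v ∈ W,
      (∀ x ∈ W, inner 𝕜 (J x) (J v) = (μ : 𝕜) * inner 𝕜 (e x) (e v)) → v = 0)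
    {v : V} (hv : v ∈ W) : ‖J v‖ ^ 2 ≤ c * ‖e v‖ ^ 2 := by
  have hWe : IsClosed ((W.map (e : V →ₗ[𝕜] H) : Submodule 𝕜 H) : Set H) :=
    e.toHomeomorph.isClosedMap _ hW
  have : CompleteSpace (W.map (e : V →ₗ[𝕜] H) : Submodule 𝕜 H) := hWe.completeSpace_coe
  have hmain := norm_sq_le_of_forall_eigenvalue_le (J ∘L (e.symm : H →L[𝕜] V))
    (hJ.comp_clm (e.symm : H →L[𝕜] V)) (W.map (e : V →ₗ[𝕜] H)) hc (by
      rintro μ hcμ _ ⟨y, hy, rfl⟩ hx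
      have : y = 0 := h μ hcμ y hy fun x hxW => by
        simpa using hx (e x) ⟨x, hxW, rfl⟩
      simp [this]) (v := e v) ⟨v, hv, rfl⟩
  simpa using hmain

end Hilbert

/-! ### Spectral truncation and subspace iteration in one local space. -/

section Local

variable {𝕜 V H G : Type*} [RCLike 𝕜] [AddCommGroup V] [Module 𝕜 V] [NormedAddCommGroup H]
  [InnerProductSpace 𝕜 H] [NormedAddCommGroup G] [InnerProductSpace 𝕜 G]
  (e : V →ₗ[𝕜] H) (J : V →ₗ[𝕜] G) (U : Submodule 𝕜 V)

/-- `w` is the solution in `U` of the variational problem with right-hand side `g`. -/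
def VarSolves (w : V) (g : G) : Prop :=
  w ∈ U ∧ ∀ v ∈ U, inner 𝕜 (e v) (e w) = inner 𝕜 (J v) g

/-- The elements of `U` that are `L²`-orthogonal to the first `ℓ` members of `φ`. -/
def tailSpace (φ : ℕ → V) (ℓ : ℕ) : Submodule 𝕜 V where
  carrier := {v | v ∈ U ∧ ∀ j < ℓ, inner 𝕜 (J (φ j)) (J v) = 0}
  zero_mem' := ⟨U.zero_mem, fun j _ => by simp⟩
  add_mem' := fun hx hy => ⟨U.add_mem hx.1 hy.1, fun j hj => by
    rw [map_add, inner_add_right, hx.2 j hj, hy.2 j hj, add_zero]⟩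
  smul_mem' := fun c x hx => ⟨U.smul_mem c hx.1, fun j hj => by
    rw [map_smul, inner_smul_right, hx.2 j hj, mul_zero]⟩

variable {e J U} {φ : ℕ → V} {lam : ℕ → ℝ} {ℓ : ℕ}

theorem mem_tailSpace {v : V} :
    v ∈ tailSpace J U φ ℓ ↔ v ∈ U ∧ ∀ j < ℓ, inner 𝕜 (J (φ j)) (J v) = 0 := Iff.rfl

theorem inner_eigen (heig : ∀ j, VarSolves e J U ((lam j : 𝕜) • φ j) (J (φ j))) (j : ℕ) {v : V}
    (hv : v ∈ U) : inner 𝕜 (J v) (J (φ j)) = (lam j : 𝕜) * inner 𝕜 (e v) (e (φ j)) := by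
  rw [← (heig j).2 v hv, map_smul, inner_smul_right]

/-- Testing the eigenvalue equation with `φ j` itself gives `1 = lam j * ‖e (φ j)‖ ^ 2`. -/
theorem eigenvalue_pos (hmem : ∀ j, φ j ∈ U) (horth : Orthonormal 𝕜 fun j => J (φ j))
    (heig : ∀ j, VarSolves e J U ((lam j : 𝕜) • φ j) (J (φ j))) (j : ℕ) : 0 < lam j := by
  have h := inner_eigen heig j (hmem j)
  rw [inner_self_eq_norm_sq_to_K, inner_self_eq_norm_sq_to_K, horth.1 j] at h
  have h' : (1 : ℝ) = lam j * ‖e (φ j)‖ ^ 2 := by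
    apply RCLike.ofReal_injective (K := 𝕜)
    push_cast
    simpa using h
  by_contra! hneg
  nlinarith [sq_nonneg ‖e (φ j)‖]

/-- For eigenfunctions the L² and energy products with `v` differ by the nonzero factor `lam j`, so
both orthogonalities agree. -/
theorem inner_eigen_eq_zero (hmem : ∀ j, φ j ∈ U) (horth : Orthonormal 𝕜 fun j => J (φ j))
    (heig : ∀ j, VarSolves e J U ((lam j : 𝕜) • φ j) (J (φ j))) {j : ℕ} (hj : j < ℓ) {v : V}
    (hv : v ∈ tailSpace J U φ ℓ) : inner 𝕜 (e v) (e (φ j)) = 0 := by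
  have h := inner_eigen heig j hv.1
  rw [← inner_conj_symm, hv.2 j hj, map_zero] at h
  have hl : (lam j : 𝕜) ≠ 0 := by exact_mod_cast (eigenvalue_pos hmem horth heig j).ne'
  exact (mul_eq_zero.1 h.symm).resolve_left hl

theorem sub_sum_mem_tailSpace (hmem : ∀ j, φ j ∈ U) (horth : Orthonormal 𝕜 fun j => J (φ j))
    {w : V} (hw : w ∈ U) :
    w - ∑ j ∈ Finset.range ℓ, inner 𝕜 (J (φ j)) (J w) • φ j ∈ tailSpace J U φ ℓ := by
  refine ⟨U.sub_mem hw (U.sum_mem fun j _ => U.smul_mem _ (hmem j)), fun i hi => ?_⟩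
  simp only [map_sub, map_sum, map_smul, inner_sub_right, inner_sum, inner_smul_right,
    orthonormal_iff_ite.1 horth]
  simp [hi]

/-- The spectral bound on the tail space gives the error of the spectral projection. -/
theorem norm_sub_spectral_sum_le (hmem : ∀ j, φ j ∈ U) (horth : Orthonormal 𝕜 fun j => J (φ j))
    (heig : ∀ j, VarSolves e J U ((lam j : 𝕜) • φ j) (J (φ j)))
    (hP : ∀ v ∈ tailSpace J U φ ℓ, ‖J v‖ ^ 2 ≤ lam ℓ * ‖e v‖ ^ 2) {w : V} {g : G}
    (hw : VarSolves e J U w g) :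
    ‖e (w - ∑ j ∈ Finset.range ℓ, inner 𝕜 (J (φ j)) (J w) • φ j)‖ ≤ Real.sqrt (lam ℓ) * ‖g‖ := by
  have hr := sub_sum_mem_tailSpace (ℓ := ℓ) hmem horth hw.1
  set r := w - ∑ j ∈ Finset.range ℓ, inner 𝕜 (J (φ j)) (J w) • φ j with hrdef
  have hl := (eigenvalue_pos hmem horth heig ℓ).le
  -- The remainder `r` is energy-orthogonal to the subtracted sum, so `w` may replace `r` in one
  -- slot.
  have h1 : inner 𝕜 (e r) (e r) = inner 𝕜 (J r) g := by
    rw [← hw.2 r hr.1]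
    conv_lhs => enter [3]; rw [hrdef, map_sub]
    rw [inner_sub_right]
    rw [map_sum, inner_sum, Finset.sum_eq_zero, sub_zero]
    intro j hj
    rw [map_smul, inner_smul_right,
      inner_eigen_eq_zero hmem horth heig (Finset.mem_range.1 hj) hr, mul_zero]
  have h2 : ‖J r‖ ≤ Real.sqrt (lam ℓ) * ‖e r‖ := by
    refine abs_le_of_sq_le_sq' ?_ (by positivity) |>.2
    rw [mul_pow, Real.sq_sqrt hl]
    exact hP r hr
  have h3 : ‖e r‖ ^ 2 ≤ ‖J r‖ * ‖g‖ := by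
    rw [← inner_self_eq_norm_sq (𝕜 := 𝕜), h1]
    exact re_inner_le_norm _ _
  have h4 : ‖e r‖ * ‖e r‖ ≤ (Real.sqrt (lam ℓ) * ‖g‖) * ‖e r‖ := by
    nlinarith [mul_le_mul_of_nonneg_right h2 (norm_nonneg g)]
  rcases (norm_nonneg (e r)).eq_or_lt with h0 | h0
  · rw [← h0]; positivity
  · exact le_of_mul_le_mul_right h4 h0

/-- The solution operator leaves the tail space invariant and is bounded there by `lam ℓ`. -/
theorem tailSpace_contract (hmem : ∀ j, φ j ∈ U) (horth : Orthonormal 𝕜 fun j => J (φ j))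
    (heig : ∀ j, VarSolves e J U ((lam j : 𝕜) • φ j) (J (φ j)))
    (hP : ∀ v ∈ tailSpace J U φ ℓ, ‖J v‖ ^ 2 ≤ lam ℓ * ‖e v‖ ^ 2) {r s : V}
    (hr : r ∈ tailSpace J U φ ℓ) (hs : VarSolves e J U s (J r)) :
    s ∈ tailSpace J U φ ℓ ∧ ‖e s‖ ≤ lam ℓ * ‖e r‖ := by
  have hl := (eigenvalue_pos hmem horth heig ℓ).le
  -- Symmetry of the solution operator: `(s, φ_j) = λ_j a(s, φ_j) = λ_j (r, φ_j) = 0`.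
  have hsW : s ∈ tailSpace J U φ ℓ := by
    refine ⟨hs.1, fun j hj => ?_⟩
    rw [← inner_conj_symm, inner_eigen heig j hs.1, ← inner_conj_symm, hs.2 _ (hmem j), hr.2 j hj]
    simp
  refine ⟨hsW, ?_⟩
  have hsq : ∀ v ∈ tailSpace J U φ ℓ, ‖J v‖ ≤ Real.sqrt (lam ℓ) * ‖e v‖ := fun v hv => by
    refine abs_le_of_sq_le_sq' ?_ (by positivity) |>.2
    rw [mul_pow, Real.sq_sqrt hl]
    exact hP v hv
  have h1 : ‖e s‖ ^ 2 ≤ ‖J s‖ * ‖J r‖ := by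
    rw [← inner_self_eq_norm_sq (𝕜 := 𝕜), hs.2 s hs.1]
    exact re_inner_le_norm _ _
  -- The tail bound is used for both `s` and `r`; the two square roots multiply to `lam ℓ`.
  have h2 : ‖e s‖ * ‖e s‖ ≤ (lam ℓ * ‖e r‖) * ‖e s‖ := by
    calc ‖e s‖ * ‖e s‖ = ‖e s‖ ^ 2 := (sq _).symm
      _ ≤ ‖J s‖ * ‖J r‖ := h1
      _ ≤ (Real.sqrt (lam ℓ) * ‖e s‖) * (Real.sqrt (lam ℓ) * ‖e r‖) := by
        gcongr
        · exact hsq s hsW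
        · exact hsq r hr
      _ = (Real.sqrt (lam ℓ) * Real.sqrt (lam ℓ)) * ‖e r‖ * ‖e s‖ := by ring
      _ = _ := by rw [Real.mul_self_sqrt hl]
  rcases (norm_nonneg (e s)).eq_or_lt with h0 | h0
  · rw [← h0]; positivity
  · exact le_of_mul_le_mul_right h2 h0

/-- One step of the subspace iteration maps onto the image of the old span under the
solution operator. -/
theorem exists_varSolves_mem_span (he : Function.Injective e) {b b' : Fin ℓ → V}
    (hstep : ∀ k, b' k ∈ U ∧ ∃ μ : Fin ℓ → 𝕜,
      (∀ v ∈ U, inner 𝕜 (e v) (e (b' k)) + ∑ j, μ j * inner 𝕜 (J v) (J (b j)) = 0) ∧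
      ∀ j, inner 𝕜 (J (b' k)) (J (b j)) = if j = k then 1 else 0)
    {s : V} (hs : s ∈ Submodule.span 𝕜 (Set.range b)) :
    ∃ s' ∈ Submodule.span 𝕜 (Set.range b'), VarSolves e J U s' (J s) := by
  choose hU μ hμ hbi using hstep
  -- If `c` are the coordinates of a combination of the `b'`, then `F c` are coordinates, in the
  -- `b`, of the right-hand side it solves for.
  let F : (Fin ℓ → 𝕜) →ₗ[𝕜] (Fin ℓ → 𝕜) :=
    { toFun := fun c j => -∑ k, c k * μ k j
      map_add' := fun c c' => by
        funext j; simp only [Pi.add_apply, add_mul, Finset.sum_add_distrib, neg_add]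
      map_smul' := fun t c => by
        funext j
        simp only [Pi.smul_apply, smul_eq_mul, mul_assoc, ← Finset.mul_sum, RingHom.id_apply,
          mul_neg] }
  have key : ∀ (c : Fin ℓ → 𝕜), ∀ v ∈ U, inner 𝕜 (e v) (e (∑ k, c k • b' k)) =
      inner 𝕜 (J v) (J (∑ j, F c j • b j)) := fun c v hv => by
    simp only [map_sum, map_smul, inner_sum, inner_smul_right]
    have h1 : ∀ k, inner 𝕜 (e v) (e (b' k)) = -∑ j, μ k j * inner 𝕜 (J v) (J (b j)) :=
      fun k => eq_neg_of_add_eq_zero_left (hμ k v hv)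
    simp only [h1, F, LinearMap.coe_mk, AddHom.coe_mk, neg_mul, Finset.sum_mul, mul_neg,
      Finset.mul_sum, Finset.sum_neg_distrib]
    rw [Finset.sum_comm]
    simp only [mul_assoc]
  have hmem : ∀ c : Fin ℓ → 𝕜, ∑ k, c k • b' k ∈ U := fun c =>
    U.sum_mem fun k _ => U.smul_mem _ (hU k)
  -- A zero right-hand side forces a zero solution, and biorthogonality to the `b j` then reads off
  -- `c = 0`. Since `F` is square, it is also surjective.
  have hinj : Function.Injective F := by
    rw [injective_iff_map_eq_zero]
    intro c hc
    have h0 : ∑ k, c k • b' k = 0 := by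
      have h := key c _ (hmem c)
      rw [hc] at h
      simp only [Pi.zero_apply, zero_smul, Finset.sum_const_zero, map_zero, inner_zero_right] at h
      exact he (by rw [inner_self_eq_zero.1 h, map_zero])
    funext j
    have h := congrArg (fun v => inner 𝕜 (J (b j)) (J v)) h0
    have hb : ∀ k, inner 𝕜 (J (b j)) (J (b' k)) = if j = k then (1 : 𝕜) else 0 := fun k => by
      rw [← inner_conj_symm, hbi k j]; split_ifs <;> simp
    simpa [map_sum, map_smul, inner_sum, inner_smul_right, hb] using h
  obtain ⟨x, rfl⟩ := (Submodule.mem_span_range_iff_exists_fun 𝕜).1 hs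
  obtain ⟨c, rfl⟩ := LinearMap.injective_iff_surjective.1 hinj x
  exact ⟨_, Submodule.sum_mem _ fun k _ => Submodule.smul_mem _ _ (Submodule.subset_span ⟨k, rfl⟩),
    hmem c, key c⟩

/-- A nondegenerate initial space contains, for each of the first eigenfunctions, an element
whose spectral projection is this eigenfunction. -/
theorem exists_mem_span_sub_mem_tailSpace (hmem : ∀ j, φ j ∈ U)
    (horth : Orthonormal 𝕜 fun j => J (φ j)) {b : Fin ℓ → V} (hb : ∀ k, b k ∈ U)
    (hrank : LinearIndependent 𝕜 fun k =>
      ∑ j ∈ Finset.range ℓ, inner 𝕜 (J (φ j)) (J (b k)) • φ j) {i : ℕ} (hi : i < ℓ) :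
    ∃ s ∈ Submodule.span 𝕜 (Set.range b), s - φ i ∈ tailSpace J U φ ℓ := by
  -- The first `ℓ` eigen-coordinates of a combination of the `b k`: injective by the rank condition,
  -- hence onto, and a preimage of the `i`-th unit vector is the element sought.
  let F : (Fin ℓ → 𝕜) →ₗ[𝕜] (Fin ℓ → 𝕜) :=
    { toFun := fun c j => inner 𝕜 (J (φ j)) (J (∑ k, c k • b k))
      map_add' := fun c c' => by
        funext j
        simp only [Pi.add_apply, add_smul, Finset.sum_add_distrib, map_add, inner_add_right]
      map_smul' := fun t c => by
        funext j
        simp only [Pi.smul_apply, smul_eq_mul, mul_smul, ← Finset.smul_sum, map_smul,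
          inner_smul_right, RingHom.id_apply] }
  have hinj : Function.Injective F := by
    rw [injective_iff_map_eq_zero]
    intro c hc
    have h0 : ∑ k, c k • ∑ j ∈ Finset.range ℓ, inner 𝕜 (J (φ j)) (J (b k)) • φ j = 0 := by
      simp only [Finset.smul_sum, smul_smul]
      rw [Finset.sum_comm]
      refine Finset.sum_eq_zero fun j hj => ?_
      rw [← Finset.sum_smul]
      have h := congrFun hc ⟨j, Finset.mem_range.1 hj⟩
      simp only [F, LinearMap.coe_mk, AddHom.coe_mk, map_sum, map_smul, inner_sum,
        inner_smul_right, Pi.zero_apply] at h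
      rw [h, zero_smul]
    funext k
    exact Fintype.linearIndependent_iff.1 hrank c h0 k
  obtain ⟨c, hc⟩ := LinearMap.injective_iff_surjective.1 hinj (Pi.single ⟨i, hi⟩ 1)
  refine ⟨∑ k, c k • b k,
    Submodule.sum_mem _ fun k _ => Submodule.smul_mem _ _ (Submodule.subset_span ⟨k, rfl⟩),
    U.sub_mem (U.sum_mem fun k _ => U.smul_mem _ (hb k)) (hmem i), fun j hj => ?_⟩
  have h := congrFun hc ⟨j, hj⟩
  simp only [F, LinearMap.coe_mk, AddHom.coe_mk] at h
  rw [map_sub, inner_sub_right, h, orthonormal_iff_ite.1 horth]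
  simp [Pi.single_apply]

/-- Convergence of the subspace iteration to the first eigenfunctions. -/
theorem exists_iterate_near_eigen (he : Function.Injective e) (hmem : ∀ j, φ j ∈ U)
    (horth : Orthonormal 𝕜 fun j => J (φ j))
    (heig : ∀ j, VarSolves e J U ((lam j : 𝕜) • φ j) (J (φ j)))
    (hP : ∀ v ∈ tailSpace J U φ ℓ, ‖J v‖ ^ 2 ≤ lam ℓ * ‖e v‖ ^ 2)
    {b : ℕ → Fin ℓ → V} (hb : ∀ k, b 0 k ∈ U)
    (hrank : LinearIndependent 𝕜 fun k =>
      ∑ j ∈ Finset.range ℓ, inner 𝕜 (J (φ j)) (J (b 0 k)) • φ j)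
    (hstep : ∀ n k, b (n + 1) k ∈ U ∧ ∃ μ : Fin ℓ → 𝕜,
      (∀ v ∈ U, inner 𝕜 (e v) (e (b (n + 1) k)) + ∑ j, μ j * inner 𝕜 (J v) (J (b n j)) = 0) ∧
      ∀ j, inner 𝕜 (J (b (n + 1) k)) (J (b n j)) = if j = k then 1 else 0)
    {i : ℕ} (hi : i < ℓ) :
    ∃ C : ℝ, 0 ≤ C ∧ ∀ n, ∃ s ∈ Submodule.span 𝕜 (Set.range (b n)),
      ‖e (s - φ i)‖ ≤ (lam ℓ / lam i) ^ n * C := by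
  obtain ⟨s₀, hs₀, hs₀W⟩ := exists_mem_span_sub_mem_tailSpace hmem horth hb hrank hi
  refine ⟨‖e (s₀ - φ i)‖, norm_nonneg _, fun n => ?_⟩
  -- Tail membership is carried through the induction because the contraction holds only there.
  suffices h : ∃ s ∈ Submodule.span 𝕜 (Set.range (b n)), s - φ i ∈ tailSpace J U φ ℓ ∧
      ‖e (s - φ i)‖ ≤ (lam ℓ / lam i) ^ n * ‖e (s₀ - φ i)‖ by
    obtain ⟨s, h1, -, h2⟩ := h
    exact ⟨s, h1, h2⟩
  induction n with
  | zero => exact ⟨s₀, hs₀, hs₀W, by simp⟩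
  | succ n ih =>
    obtain ⟨s, hs, hsW, hsn⟩ := ih
    obtain ⟨t, ht, htS⟩ := exists_varSolves_mem_span he (hstep n) hs
    have hli := eigenvalue_pos hmem horth heig i
    have hl := eigenvalue_pos hmem horth heig ℓ
    have hli' : (lam i : 𝕜) ≠ 0 := by exact_mod_cast hli.ne'
    -- Both `t` and `lam i • φ i` are images under the solution operator, of `s` and `φ i`. Dividing
    -- by `lam i` then keeps the target `φ i` fixed.
    have hdiff : VarSolves e J U (t - (lam i : 𝕜) • φ i) (J (s - φ i)) :=
      ⟨U.sub_mem htS.1 (heig i).1, fun v hv => by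
        rw [map_sub, inner_sub_right, htS.2 v hv, (heig i).2 v hv, map_sub, inner_sub_right]⟩
    obtain ⟨hW, hn⟩ := tailSpace_contract hmem horth heig hP hsW hdiff
    have heq : (lam i : 𝕜)⁻¹ • t - φ i = (lam i : 𝕜)⁻¹ • (t - (lam i : 𝕜) • φ i) := by
      rw [smul_sub, smul_smul, inv_mul_cancel₀ hli', one_smul]
    refine ⟨(lam i : 𝕜)⁻¹ • t, Submodule.smul_mem _ _ ht, heq ▸ Submodule.smul_mem _ _ hW, ?_⟩
    rw [heq, map_smul, norm_smul, norm_inv, RCLike.norm_ofReal, abs_of_pos hli, pow_succ]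
    calc (lam i)⁻¹ * ‖e (t - (lam i : 𝕜) • φ i)‖
        ≤ (lam i)⁻¹ * (lam ℓ * ((lam ℓ / lam i) ^ n * ‖e (s₀ - φ i)‖)) := by
          gcongr
          exact hn.trans (by gcongr)
      _ = _ := by ring

/-- Approximation of local solutions by the iterated local spaces. -/
theorem exists_local_approx (he : Function.Injective e) (hmem : ∀ j, φ j ∈ U)
    (horth : Orthonormal 𝕜 fun j => J (φ j))
    (heig : ∀ j, VarSolves e J U ((lam j : 𝕜) • φ j) (J (φ j))) (hanti : Antitone lam)
    (hP : ∀ v ∈ tailSpace J U φ ℓ, ‖J v‖ ^ 2 ≤ lam ℓ * ‖e v‖ ^ 2)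
    {b : ℕ → Fin ℓ → V} (hb : ∀ k, b 0 k ∈ U)
    (hrank : LinearIndependent 𝕜 fun k =>
      ∑ j ∈ Finset.range ℓ, inner 𝕜 (J (φ j)) (J (b 0 k)) • φ j)
    (hstep : ∀ n k, b (n + 1) k ∈ U ∧ ∃ μ : Fin ℓ → 𝕜,
      (∀ v ∈ U, inner 𝕜 (e v) (e (b (n + 1) k)) + ∑ j, μ j * inner 𝕜 (J v) (J (b n j)) = 0) ∧
      ∀ j, inner 𝕜 (J (b (n + 1) k)) (J (b n j)) = if j = k then 1 else 0) :
    ∃ C : ℝ, 0 ≤ C ∧ ∀ (w : V) (g : G), VarSolves e J U w g → ∀ n,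
      ∃ s ∈ Submodule.span 𝕜 (Set.range (b n)),
        ‖e (w - s)‖ ≤ Real.sqrt (lam ℓ) * ‖g‖ + C * (lam ℓ / lam (ℓ - 1)) ^ n * ‖J w‖ := by
  have hnear : ∀ i : Fin ℓ, ∃ C : ℝ, 0 ≤ C ∧ ∀ n, ∃ s ∈ Submodule.span 𝕜 (Set.range (b n)),
      ‖e (s - φ i)‖ ≤ (lam ℓ / lam i) ^ n * C :=
    fun i => exists_iterate_near_eigen he hmem horth heig hP hb hrank hstep i.2
  choose C hC0 s hs hsn using hnear
  -- The approximants and the `C i` are chosen before `w` and `g`, so the constant is uniform in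
  -- them.
  refine ⟨∑ i, C i, Finset.sum_nonneg fun i _ => hC0 i, fun w g hw n => ?_⟩
  refine ⟨∑ i : Fin ℓ, inner 𝕜 (J (φ i)) (J w) • s i n,
    Submodule.sum_mem _ fun i _ => Submodule.smul_mem _ _ (hs i n), ?_⟩
  -- The spectral coefficients of `w` are kept and only the `φ i` are replaced: truncation error
  -- minus iteration error.
  have hsplit : w - ∑ i : Fin ℓ, inner 𝕜 (J (φ i)) (J w) • s i n =
      (w - ∑ j ∈ Finset.range ℓ, inner 𝕜 (J (φ j)) (J w) • φ j) -
        ∑ i : Fin ℓ, inner 𝕜 (J (φ i)) (J w) • (s i n - φ i) := by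
    rw [Finset.sum_range (fun j => inner 𝕜 (J (φ j)) (J w) • φ j)]
    simp only [smul_sub, Finset.sum_sub_distrib]
    abel
  rw [hsplit, map_sub]
  refine (norm_sub_le _ _).trans (add_le_add
    (norm_sub_spectral_sum_le hmem horth heig hP hw) ?_)
  rw [map_sum, Finset.sum_mul, Finset.sum_mul]
  refine (norm_sum_le _ _).trans (Finset.sum_le_sum fun i _ => ?_)
  rw [map_smul, norm_smul]
  have hl := eigenvalue_pos hmem horth heig
  have hin : ‖inner 𝕜 (J (φ i)) (J w)‖ ≤ ‖J w‖ := by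
    simpa [horth.1 i] using norm_inner_le_norm (𝕜 := 𝕜) (J (φ i)) (J w)
  -- Indices start at zero: `lam ℓ` is `λ^{ℓ+1}` and `lam (ℓ - 1)` is `λ^ℓ`, the smallest
  -- denominator that occurs.
  have hratio : lam ℓ / lam i ≤ lam ℓ / lam (ℓ - 1) :=
    div_le_div_of_nonneg_left (hl ℓ).le (hl _) (hanti (by omega))
  calc ‖inner 𝕜 (J (φ i)) (J w)‖ * ‖e (s i n - φ i)‖
      ≤ ‖J w‖ * ((lam ℓ / lam (ℓ - 1)) ^ n * C i) := by
        gcongr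
        refine (hsn i n).trans ?_
        have := hC0 i
        have := (div_pos (hl ℓ) (hl i)).le
        gcongr
    _ = _ := by ring

/-- The bound of `J` on the tail space by the first eigenvalue that is left out. -/
theorem norm_sq_le_on_tailSpace (hmem : ∀ j, φ j ∈ U)
    (horth : Orthonormal 𝕜 fun j => J (φ j))
    (heig : ∀ j, VarSolves e J U ((lam j : 𝕜) • φ j) (J (φ j))) (hanti : Antitone lam)
    (hexh : ∀ (μ : ℝ) (ψ : V), ψ ∈ U → VarSolves e J U ((μ : 𝕜) • ψ) (J ψ) →
      (∀ j, inner 𝕜 (J (φ j)) (J ψ) = 0) → ψ = 0)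
    (hspec : ∀ c : ℝ, 0 ≤ c →
      (∀ μ : ℝ, c < μ → ∀ v ∈ tailSpace J U φ ℓ, (∀ x ∈ tailSpace J U φ ℓ,
        inner 𝕜 (J x) (J v) = (μ : 𝕜) * inner 𝕜 (e x) (e v)) → v = 0) →
      ∀ v ∈ tailSpace J U φ ℓ, ‖J v‖ ^ 2 ≤ c * ‖e v‖ ^ 2) :
    ∀ v ∈ tailSpace J U φ ℓ, ‖J v‖ ^ 2 ≤ lam ℓ * ‖e v‖ ^ 2 := by
  refine hspec _ (eigenvalue_pos hmem horth heig ℓ).le fun μ hμ v hv hvW => ?_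
  -- An eigenvector relative to the tail is one relative to `U`: on the span of the first `ℓ`
  -- eigenfunctions both sides of the equation vanish.
  have hsol : VarSolves e J U ((μ : 𝕜) • v) (J v) := by
    refine ⟨U.smul_mem _ hv.1, fun x hx => ?_⟩
    have h := hvW _ (sub_sum_mem_tailSpace (ℓ := ℓ) hmem horth hx)
    rw [map_smul, inner_smul_right]
    simp only [map_sub, map_sum, map_smul, inner_sub_left, sum_inner, inner_smul_left] at h
    have h1 : ∀ j ∈ Finset.range ℓ, inner 𝕜 (e (φ j)) (e v) = 0 := fun j hj => by
      rw [← inner_conj_symm, inner_eigen_eq_zero hmem horth heig (Finset.mem_range.1 hj) hv,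
        map_zero]
    rw [Finset.sum_eq_zero fun j hj => by rw [hv.2 j (Finset.mem_range.1 hj), mul_zero],
      Finset.sum_eq_zero fun j hj => by rw [h1 j hj, mul_zero], sub_zero, sub_zero] at h
    exact h.symm
  refine hexh μ v hv.1 hsol fun j => ?_
  -- Early `j` are covered by tail membership; for the others `lam j ≤ lam ℓ < μ`, and distinct
  -- eigenvalues give orthogonality.
  rcases lt_or_ge j ℓ with hj | hj
  · exact hv.2 j hj
  · have h1 := inner_eigen heig j hv.1
    have h2 := hsol.2 _ (hmem j)
    rw [map_smul, inner_smul_right] at h2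
    have h3 := congrArg (starRingEnd 𝕜) h1
    rw [map_mul, inner_conj_symm, inner_conj_symm, RCLike.conj_ofReal] at h3
    have hne : (μ : 𝕜) - (lam j : 𝕜) ≠ 0 := by
      rw [← RCLike.ofReal_sub]
      exact_mod_cast (sub_pos.2 ((hanti hj).trans_lt hμ)).ne'
    have h4 : ((μ : 𝕜) - (lam j : 𝕜)) * inner 𝕜 (e (φ j)) (e v) = 0 := by
      rw [sub_mul, h2, h3, sub_self]
    rw [h3, (mul_eq_zero.1 h4).resolve_left hne, mul_zero]

end Local

end LSSI

namespace LSSI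

/-! ### The Sobolev space, the form and the partition of unity. -/

section Sobolev

variable {𝕜 : Type*} [RCLike 𝕜] {r m d : ℕ} {Ω : Set (Pt d)}

/-- The embedding `V → L²(Ω; 𝕜^r)` as a continuous linear map. -/
noncomputable def toL2CLM : Sob 𝕜 r m Ω →L[𝕜] L2 𝕜 r Ω :=
  (PiLp.proj 2 (fun _ : DIdx d m => L2 𝕜 r Ω) (DIdx.zero d m)) ∘L (sobolevZero 𝕜 r m Ω).subtypeL

theorem toL2CLM_apply (u : Sob 𝕜 r m Ω) : toL2CLM u = toL2 u := rfl

/-- Multiplication by an essentially bounded measurable matrix is bounded on `L²`. -/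
theorem exists_multiplication_operator {M : Pt d → (Val 𝕜 r →L[𝕜] Val 𝕜 r)}
    (hM : AEStronglyMeasurable M (volume.restrict Ω)) {K : ℝ}
    (hK : ∀ᵐ x ∂(volume.restrict Ω), ‖M x‖ ≤ K) :
    ∃ T : L2 𝕜 r Ω →L[𝕜] L2 𝕜 r Ω, ∀ f, T f =ᵐ[volume.restrict Ω] fun x => M x (f x) := by
  have hle : ∀ f : L2 𝕜 r Ω, ∀ᵐ x ∂(volume.restrict Ω), ‖M x (f x)‖ ≤ K * ‖f x‖ := fun f => by
    filter_upwards [hK] with x hx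
    exact (M x).le_of_opNorm_le hx _
  have hmem : ∀ f : L2 𝕜 r Ω, MemLp (fun x => M x (f x)) 2 (volume.restrict Ω) := fun f =>
    (Lp.memLp f).of_le_mul (isBoundedBilinearMap_apply.continuous.comp_aestronglyMeasurable
      (hM.prodMk (Lp.aestronglyMeasurable f))) (hle f)
  refine ⟨LinearMap.mkContinuous
    { toFun := fun f => (hmem f).toLp
      map_add' := fun f g => ?_
      map_smul' := fun c f => ?_ } K fun f => ?_, fun f => (hmem f).coeFn_toLp⟩
  · apply Lp.ext
    filter_upwards [(hmem (f + g)).coeFn_toLp, (hmem f).coeFn_toLp, (hmem g).coeFn_toLp,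
      Lp.coeFn_add f g, Lp.coeFn_add (hmem f).toLp (hmem g).toLp] with x h1 h2 h3 h4 h5
    rw [h1, h5, h4, Pi.add_apply, Pi.add_apply, h2, h3, map_add]
  · apply Lp.ext
    filter_upwards [(hmem (c • f)).coeFn_toLp, (hmem f).coeFn_toLp,
      Lp.coeFn_smul c f, Lp.coeFn_smul c (hmem f).toLp] with x h1 h2 h3 h4
    rw [h1, RingHom.id_apply, h4, h3, Pi.smul_apply, Pi.smul_apply, h2, map_smul]
  · apply Lp.norm_le_mul_norm_of_ae_le_mul
    filter_upwards [(hmem f).coeFn_toLp, hle f] with x h1 h2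
    exact (congrArg norm h1).trans_le h2

theorem norm_weakDeriv_le (s : DIdx d m) (u : Sob 𝕜 r m Ω) : ‖weakDeriv s u‖ ≤ ‖u‖ :=
  PiLp.norm_apply_le (u : Jet 𝕜 r m Ω) s

/-- The form is built from bounded operators of `L²`. -/
theorem exists_form_eq_sum_inner {A : Coeff 𝕜 r m d} (hA : BoundedCoeff Ω A) :
    ∃ T : DIdx d m → DIdx d m → (L2 𝕜 r Ω →L[𝕜] L2 𝕜 r Ω), ∀ u v : Sob 𝕜 r m Ω,
      form A u v = ∑ s, ∑ t, inner 𝕜 (weakDeriv s v) (T s t (weakDeriv t u)) := by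
  have h : ∀ s t, ∃ T : L2 𝕜 r Ω →L[𝕜] L2 𝕜 r Ω, ∀ f,
      T f =ᵐ[volume.restrict Ω] fun x => A s t x (f x) := fun s t => by
    obtain ⟨hm, K, hK⟩ := hA s t
    exact exists_multiplication_operator hm hK
  choose T hT using h
  refine ⟨T, fun u v => Finset.sum_congr rfl fun s _ => Finset.sum_congr rfl fun t _ => ?_⟩
  rw [L2.inner_def]
  refine integral_congr_ae ?_
  filter_upwards [hT s t (weakDeriv t u)] with x hx
  rw [hx]

/-- Additivity of the integral needs integrable integrands; writing the form through bounded L²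
operators settles this. -/
theorem form_add_left {A : Coeff 𝕜 r m d} (hA : BoundedCoeff Ω A) (u v w : Sob 𝕜 r m Ω) :
    form A (u + v) w = form A u w + form A v w := by
  obtain ⟨T, hT⟩ := exists_form_eq_sum_inner hA
  have h : ∀ t, weakDeriv t (u + v) = weakDeriv t u + weakDeriv t v := fun t => rfl
  simp only [hT, h, map_add, inner_add_right, Finset.sum_add_distrib]

theorem form_smul_left {A : Coeff 𝕜 r m d} (hA : BoundedCoeff Ω A) (c : 𝕜) (u w : Sob 𝕜 r m Ω) :
    form A (c • u) w = c * form A u w := by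
  obtain ⟨T, hT⟩ := exists_form_eq_sum_inner hA
  have h : ∀ t, weakDeriv t (c • u) = c • weakDeriv t u := fun t => rfl
  simp only [hT, h, map_smul, inner_smul_right, Finset.mul_sum]

theorem exists_norm_form_le {A : Coeff 𝕜 r m d} (hA : BoundedCoeff Ω A) :
    ∃ M : ℝ, ∀ v : Sob 𝕜 r m Ω, ‖form A v v‖ ≤ M * ‖v‖ ^ 2 := by
  obtain ⟨T, hT⟩ := exists_form_eq_sum_inner hA
  refine ⟨∑ s, ∑ t, ‖T s t‖, fun v => ?_⟩
  rw [hT, Finset.sum_mul]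
  refine (norm_sum_le _ _).trans (Finset.sum_le_sum fun s _ => ?_)
  rw [Finset.sum_mul]
  refine (norm_sum_le _ _).trans (Finset.sum_le_sum fun t _ => ?_)
  calc ‖inner 𝕜 (weakDeriv s v) (T s t (weakDeriv t v))‖
      ≤ ‖weakDeriv s v‖ * ‖T s t (weakDeriv t v)‖ := norm_inner_le_norm _ _
    _ ≤ ‖v‖ * (‖T s t‖ * ‖v‖) := by
      gcongr
      · exact norm_weakDeriv_le s v
      · exact (T s t).le_opNorm_of_le (norm_weakDeriv_le t v)
    _ = _ := by ring

/-- The local spaces are closed. -/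
theorem isClosed_localSpace {ω : Set (Pt d)} (hω : IsOpen ω) :
    IsClosed (localSpace 𝕜 r m Ω ω : Set (Sob 𝕜 r m Ω)) := by
  -- The local space is the kernel of the continuous restriction to the complement of `ω`.
  let R := LpToLpRestrictCLM (Pt d) (Val 𝕜 r) 𝕜 (volume.restrict Ω) 2 ωᶜ ∘L toL2CLM (m := m)
  have h : (localSpace 𝕜 r m Ω ω : Set (Sob 𝕜 r m Ω)) = {v | R v = 0} := by
    ext v
    change (∀ᵐ x ∂(volume.restrict Ω), x ∈ ωᶜ → toL2 v x = 0) ↔ R v = 0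
    rw [← ae_restrict_iff' hω.measurableSet.compl, Lp.eq_zero_iff_ae_eq_zero]
    have hR : R v =ᵐ[(volume.restrict Ω).restrict ωᶜ] toL2 v :=
      LpToLpRestrictCLM_coeFn 𝕜 ωᶜ (toL2 v)
    constructor
    · intro hv
      exact hR.trans hv
    · intro hv
      exact hR.symm.trans hv
  rw [h]
  exact isClosed_eq R.continuous continuous_const

/-- Repeated integration by parts against a test function. -/
theorem exists_integral_smul_iteratedFDeriv_eq {E F : Type*} [NormedAddCommGroup E]
    [NormedSpace ℝ E] [FiniteDimensional ℝ E] [MeasurableSpace E] [BorelSpace E]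
    [NormedAddCommGroup F] [NormedSpace ℝ F] {μ : Measure E} [μ.IsAddHaarMeasure]
    (k : ℕ) (v : Fin k → E) {g : E → ℝ} (hg : ContDiff ℝ (⊤ : ℕ∞) g) (hgc : HasCompactSupport g) :
    ∃ g' : E → ℝ, ContDiff ℝ (⊤ : ℕ∞) g' ∧ HasCompactSupport g' ∧ ∀ φ : E → F,
      ContDiff ℝ (⊤ : ℕ∞) φ →
        ∫ x, g x • iteratedFDeriv ℝ k φ x v ∂μ = ∫ x, g' x • φ x ∂μ := by
  induction k generalizing g with
  | zero => exact ⟨g, hg, hgc, fun φ _ => by simp⟩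
  | succ k ih =>
    -- The outermost derivative, in direction `v 0`, moves onto the weight together with its sign;
    -- the remaining directions are left to induction.
    have hdg : ContDiff ℝ (⊤ : ℕ∞) fun x => -fderiv ℝ g x (v 0) :=
      ((hg.fderiv_right (m := (⊤ : ℕ∞)) (by simp)).clm_apply contDiff_const).neg
    have hdgc : HasCompactSupport fun x => fderiv ℝ g x (v 0) := hgc.fderiv_apply ℝ _
    have hdgc' : HasCompactSupport fun x => -fderiv ℝ g x (v 0) := hdgc.neg
    obtain ⟨g', hg', hgc', h⟩ := ih (Fin.tail v) hdg hdgc'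
    refine ⟨g', hg', hgc', fun φ hφ => ?_⟩
    rw [← h φ hφ]
    set ψ : E → F := fun x => iteratedFDeriv ℝ k φ x (Fin.tail v) with hψ
    have hitr : ContDiff ℝ (⊤ : ℕ∞) (iteratedFDeriv ℝ k φ) :=
      hφ.iteratedFDeriv_right (by exact_mod_cast le_top)
    have hψd : ContDiff ℝ (⊤ : ℕ∞) ψ :=
      ((ContinuousMultilinearMap.apply ℝ (fun _ : Fin k => E) F (Fin.tail v)).contDiff).comp hitr
    have hfd : ∀ x, iteratedFDeriv ℝ (k + 1) φ x v = fderiv ℝ ψ x (v 0) := fun x => by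
      rw [iteratedFDeriv_succ_apply_left]
      have h1 : HasFDerivAt (iteratedFDeriv ℝ k φ) (fderiv ℝ (iteratedFDeriv ℝ k φ) x) x :=
        (hitr.differentiable (by simp) x).hasFDerivAt
      have h2 := ((ContinuousMultilinearMap.apply ℝ (fun _ : Fin k => E) F
        (Fin.tail v)).hasFDerivAt).comp x h1
      have h3 : HasFDerivAt ψ _ x := h2
      rw [h3.fderiv]
      rfl
    simp only [hfd, neg_smul, integral_neg]
    have hψ' : Continuous fun x => fderiv ℝ ψ x (v 0) :=
      (hψd.continuous_fderiv (by simp)).clm_apply continuous_const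
    have hdgcont : Continuous fun x => fderiv ℝ g x (v 0) :=
      (hg.continuous_fderiv (by simp)).clm_apply continuous_const
    apply integral_smul_fderiv_eq_neg_fderiv_smul_of_integrable
    · exact (hdgcont.smul hψd.continuous).integrable_of_hasCompactSupport hdgc.smul_right
    · exact (hg.continuous.smul hψ').integrable_of_hasCompactSupport hgc.smul_right
    · exact (hg.continuous.smul hψd.continuous).integrable_of_hasCompactSupport hgc.smul_right
    · exact fun x _ => hg.differentiable (by simp) x
    · exact fun x _ => hψd.differentiable (by simp) x

/-- Integration against a compactly supported continuous function, tested with a vector, is a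
continuous functional on `L²`. -/
theorem exists_functional_eq_inner_integral {g : Pt d → ℝ} (hg : Continuous g)
    (hgc : HasCompactSupport g) (c : Val 𝕜 r) :
    ∃ T : L2 𝕜 r Ω →L[𝕜] 𝕜, ∀ f, T f = inner 𝕜 c (∫ x in Ω, g x • f x) := by
  have hgm : MemLp g 2 (volume.restrict Ω) := (hg.memLp_of_hasCompactSupport hgc).restrict Ω
  have hmem : MemLp (fun x => (g x : 𝕜) • c) 2 (volume.restrict Ω) :=
    ((RCLike.continuous_ofReal.comp hg).smul continuous_const).memLp_of_hasCompactSupport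
      ((hgc.comp_left (g := (fun t : ℝ => (t : 𝕜))) (by simp)).smul_right) |>.restrict Ω
  refine ⟨innerSL 𝕜 hmem.toLp, fun f => ?_⟩
  have hint : Integrable (fun x => g x • f x) (volume.restrict Ω) :=
    memLp_one_iff_integrable.1 ((Lp.memLp f).smul hgm)
  rw [innerSL_apply_apply, L2.inner_def, ← integral_inner hint c]
  refine integral_congr_ae ?_
  filter_upwards [hmem.coeFn_toLp] with x hx
  rw [hx, inner_smul_left, RCLike.conj_ofReal, RCLike.real_smul_eq_coe_smul (K := 𝕜) (g x),
    inner_smul_right]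

/-- An element of `H^m_0` is determined by its component of order zero. -/
theorem toL2_injective (hΩ : IsOpen Ω) :
    Function.Injective (toL2 : Sob 𝕜 r m Ω → L2 𝕜 r Ω) := by
  suffices h : ∀ u : Sob 𝕜 r m Ω, toL2 u = 0 → u = 0 by
    intro u v huv
    refine sub_eq_zero.1 (h (u - v) ?_)
    rw [← toL2CLM_apply, map_sub, toL2CLM_apply, toL2CLM_apply, huv, sub_self]
  intro u hu
  apply Subtype.ext
  apply PiLp.ext
  intro s
  change weakDeriv s u = 0
  have hzero : ∀ g : Pt d → ℝ, ContDiff ℝ (⊤ : ℕ∞) g → HasCompactSupport g → tsupport g ⊆ Ω →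
      ∫ x in Ω, g x • weakDeriv s u x = 0 := by
    intro g hg hgc hgΩ
    refine ext_inner_left 𝕜 fun c => ?_
    rw [inner_zero_right]
    obtain ⟨g', hg', hgc', hibp⟩ := exists_integral_smul_iteratedFDeriv_eq (F := Val 𝕜 r)
      (μ := (volume : Measure (Pt d))) (s.1 : ℕ)
      (fun l => EuclideanSpace.single (s.2 l) (1 : ℝ)) hg hgc
    obtain ⟨T, hT⟩ := exists_functional_eq_inner_integral (Ω := Ω) hg.continuous hgc c
    obtain ⟨T', hT'⟩ := exists_functional_eq_inner_integral (Ω := Ω) hg'.continuous hgc' c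
    -- `D` measures the defect in integration by parts. It vanishes on test jets, hence by
    -- continuity on their closed span.
    let D : Jet 𝕜 r m Ω →L[𝕜] 𝕜 := T ∘L PiLp.proj 2 (fun _ : DIdx d m => L2 𝕜 r Ω) s -
      T' ∘L PiLp.proj 2 (fun _ : DIdx d m => L2 𝕜 r Ω) (DIdx.zero d m)
    have hD : ∀ J, D J = T (J s) - T' (J (DIdx.zero d m)) := fun J => rfl
    have hker : sobolevZero 𝕜 r m Ω ≤ D.ker := by
      refine Submodule.topologicalClosure_minimal _ (Submodule.span_le.2 ?_) D.isClosed_ker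
      rintro J ⟨φ, hφ, hφc, hφΩ, hJ⟩
      change D J = 0
      have h1 : ∫ x in Ω, g x • J s x = ∫ x, g x • partialDeriv s φ x := by
        rw [← setIntegral_eq_integral_of_forall_compl_eq_zero (s := Ω)
          (f := fun x => g x • partialDeriv s φ x)]
        · refine integral_congr_ae ?_
          filter_upwards [hJ s] with x hx
          rw [hx]
        · intro x hx
          rw [image_eq_zero_of_notMem_tsupport fun h => hx (hgΩ h), zero_smul]
      -- The support of `g'` is not tracked, so here it is `φ` that vanishes outside `Ω`.
      have h2 : ∫ x in Ω, g' x • J (DIdx.zero d m) x = ∫ x, g' x • φ x := by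
        rw [← setIntegral_eq_integral_of_forall_compl_eq_zero (s := Ω) (f := fun x => g' x • φ x)]
        · refine integral_congr_ae ?_
          filter_upwards [hJ (DIdx.zero d m)] with x hx
          rw [hx]
          rfl
        · intro x hx
          rw [image_eq_zero_of_notMem_tsupport fun h => hx (hφΩ h), smul_zero]
      rw [hD, hT, hT', h1, h2, ← hibp φ hφ]
      exact sub_self _
    have h := hker u.2
    change D u = 0 at h
    have h0 : (u : Jet 𝕜 r m Ω) (DIdx.zero d m) = 0 := hu
    rw [hD, h0, map_zero, sub_zero, hT] at h
    exact h
  have hae := hΩ.ae_eq_zero_of_integral_contDiff_smul_eq_zero (f := weakDeriv s u)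
    (μ := volume) (locallyIntegrableOn_of_locallyIntegrable_restrict
      ((Lp.memLp (weakDeriv s u)).locallyIntegrable (by norm_num)))
    fun g hg hgc hgΩ => by
      rw [← setIntegral_eq_integral_of_forall_compl_eq_zero (s := Ω)]
      · exact hzero g hg hgc hgΩ
      · intro x hx
        rw [image_eq_zero_of_notMem_tsupport fun h => hx (hgΩ h), zero_smul]
  rw [Lp.eq_zero_iff_ae_eq_zero]
  exact (ae_restrict_iff' hΩ.measurableSet).2 hae

/-- The pieces of a partition of unity add up to the function. -/
theorem eq_sum_of_isPartition (hΩ : IsOpen Ω) {N : ℕ} {ω : Fin N → Set (Pt d)}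
    {χ : Fin N → Pt d → ℝ} (hχ : IsPartition Ω ω χ) {u : Sob 𝕜 r m Ω} {w : Fin N → Sob 𝕜 r m Ω}
    (hw : ∀ i, ∀ᵐ x ∂(volume.restrict Ω), toL2 (w i) x = ((χ i x : ℝ) : 𝕜) • toL2 u x) :
    u = ∑ i, w i := by
  -- The pieces are known only through their L² values; injectivity lifts the identity to `V`.
  apply toL2_injective hΩ
  rw [← toL2CLM_apply (∑ i, w i), map_sum]
  apply Lp.ext
  filter_upwards [ae_all_iff.2 hw, ae_restrict_mem hΩ.measurableSet,
    Lp.coeFn_finsetSum Finset.univ fun i => toL2 (w i)] with x h1 h2 h3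
  simp only [toL2CLM_apply]
  rw [h3, Finset.sum_apply]
  simp only [h1]
  rw [← Finset.sum_smul, ← RCLike.ofReal_sum, hχ.sum_eq_one x h2, RCLike.ofReal_one, one_smul]

/-- Multiplication by a bounded cut-off is bounded in `L²`, with a constant independent of the
function. -/
theorem exists_norm_toL2_le (hΩ : IsOpen Ω) {N : ℕ} {ω : Fin N → Set (Pt d)}
    {χ : Fin N → Pt d → ℝ} (hχ : IsPartition Ω ω χ) (i : Fin N) :
    ∃ M : ℝ, 0 ≤ M ∧ ∀ u w : Sob 𝕜 r m Ω,
      (∀ᵐ x ∂(volume.restrict Ω), toL2 w x = ((χ i x : ℝ) : 𝕜) • toL2 u x) →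
      ‖toL2 w‖ ≤ M * ‖toL2 u‖ := by
  obtain ⟨M, hM⟩ := hχ.bounded i
  refine ⟨|M|, abs_nonneg M, fun u w hw => Lp.norm_le_mul_norm_of_ae_le_mul ?_⟩
  filter_upwards [hw, ae_restrict_mem hΩ.measurableSet] with x h1 h2
  rw [h1, norm_smul, RCLike.norm_ofReal]
  exact mul_le_mul_of_nonneg_right ((hM x h2).trans (le_abs_self M)) (norm_nonneg _)

end Sobolev

end LSSI

namespace LSSI

/-! ### From the concrete form to the Hilbert space setting. -/

section Energy

variable {𝕜 : Type*} [RCLike 𝕜] {r m d : ℕ} {Ω : Set (Pt d)} {A : Coeff 𝕜 r m d}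
  {H : Type*} [NormedAddCommGroup H] [InnerProductSpace 𝕜 H]
  {e : Sob 𝕜 r m Ω ≃L[𝕜] H}

theorem energyNorm_eq_norm (he : ∀ u v, inner 𝕜 (e v) (e u) = form A u v) (u : Sob 𝕜 r m Ω) :
    energyNorm A u = ‖e u‖ := by
  rw [energyNorm, ← he, inner_self_eq_norm_sq, Real.sqrt_sq (norm_nonneg _)]

theorem Solves.varSolves (he : ∀ u v, inner 𝕜 (e v) (e u) = form A u v)
    {U : Submodule 𝕜 (Sob 𝕜 r m Ω)} {w : Sob 𝕜 r m Ω} {g : L2 𝕜 r Ω} (h : Solves A U w g) :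
    VarSolves (e : Sob 𝕜 r m Ω →ₗ[𝕜] H) (toL2CLM : Sob 𝕜 r m Ω →L[𝕜] L2 𝕜 r Ω).toLinearMap U w g :=
  ⟨h.1, fun v hv => (he w v).trans (h.2 v hv)⟩

theorem VarSolves.solves (he : ∀ u v, inner 𝕜 (e v) (e u) = form A u v)
    {U : Submodule 𝕜 (Sob 𝕜 r m Ω)} {w : Sob 𝕜 r m Ω} {g : L2 𝕜 r Ω}
    (h : VarSolves (e : Sob 𝕜 r m Ω →ₗ[𝕜] H)
      (toL2CLM : Sob 𝕜 r m Ω →L[𝕜] L2 𝕜 r Ω).toLinearMap U w g) : Solves A U w g :=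
  ⟨h.1, fun v hv => (he w v).symm.trans (h.2 v hv)⟩

/-- The spectral bound for functions orthogonal to the first eigenfunctions of a closed
subspace. -/
theorem IsEigensystem.norm_sq_le [CompleteSpace H] (he : ∀ u v, inner 𝕜 (e v) (e u) = form A u v)
    (hcompact : IsCompactOperator (toL2 : Sob 𝕜 r m Ω → L2 𝕜 r Ω))
    {U : Submodule 𝕜 (Sob 𝕜 r m Ω)} (hU : IsClosed (U : Set (Sob 𝕜 r m Ω))) {lam : ℕ → ℝ}
    {φ : ℕ → Sob 𝕜 r m Ω} (heig : IsEigensystem A U lam φ) (ℓ : ℕ) :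
    ∀ v ∈ tailSpace (toL2CLM : Sob 𝕜 r m Ω →L[𝕜] L2 𝕜 r Ω).toLinearMap U φ ℓ,
      ‖toL2 v‖ ^ 2 ≤ lam ℓ * ‖e v‖ ^ 2 := by
  refine norm_sq_le_on_tailSpace (e := (e : Sob 𝕜 r m Ω →ₗ[𝕜] H)) heig.mem heig.orthonormal
    (fun j => (heig.eigen j).varSolves he) heig.antitone
    (fun μ ψ hψ hs ho => heig.exhaust μ ψ hψ (VarSolves.solves he hs) ho) ?_
  intro c hc hμ v hv
  set W := tailSpace (toL2CLM : Sob 𝕜 r m Ω →L[𝕜] L2 𝕜 r Ω).toLinearMap U φ ℓ with hW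
  have hWc : IsClosed (W : Set (Sob 𝕜 r m Ω)) := by
    have hset : (W : Set (Sob 𝕜 r m Ω)) = (U : Set (Sob 𝕜 r m Ω)) ∩
        ⋂ j, ⋂ (_ : j < ℓ), {v | inner 𝕜 (toL2 (φ j)) (toL2CLM v) = 0} := by
      ext v
      rw [Set.mem_inter_iff, Set.mem_iInter₂]
      exact Iff.rfl
    rw [hset]
    refine hU.inter (isClosed_iInter fun j => isClosed_iInter fun _ =>
      isClosed_eq ?_ continuous_const)
    exact continuous_const.inner toL2CLM.continuous
  exact norm_sq_le_of_forall_eigenvalue_le' e toL2CLM hcompact W hWc hc hμ hv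

/-- The Galerkin solution is the best approximation in the energy norm. -/
theorem galerkin_norm_le (he : ∀ u v, inner 𝕜 (e v) (e u) = form A u v)
    {S : Submodule 𝕜 (Sob 𝕜 r m Ω)} {u uS v : Sob 𝕜 r m Ω} {f : L2 𝕜 r Ω} (hu : Solves A ⊤ u f)
    (huS : Solves A S uS f) (hv : v ∈ S) : ‖e (u - uS)‖ ≤ ‖e (u - v)‖ := by
  -- Galerkin orthogonality: `u` and `uS` solve the same equation against `S`.
  have horth : inner 𝕜 (e (v - uS)) (e (u - uS)) = 0 := by
    rw [map_sub e u, inner_sub_right, he, he, hu.2 _ trivial, huS.2 _ (S.sub_mem hv huS.1),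
      sub_self]
  have h1 : inner 𝕜 (e (u - uS)) (e (u - uS)) = inner 𝕜 (e (u - v)) (e (u - uS)) := by
    rw [← sub_add_sub_cancel u v uS, map_add, inner_add_left, ← map_add, sub_add_sub_cancel,
      horth, add_zero]
  have h2 : ‖e (u - uS)‖ * ‖e (u - uS)‖ ≤ ‖e (u - v)‖ * ‖e (u - uS)‖ := by
    rw [← sq, ← inner_self_eq_norm_sq (𝕜 := 𝕜), h1]
    exact re_inner_le_norm _ _
  rcases (norm_nonneg (e (u - uS))).eq_or_lt with h0 | h0
  · rw [← h0]; exact norm_nonneg _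
  · exact le_of_mul_le_mul_right h2 h0

end Energy

end LSSI

/-! ### The convergence theorem. -/

theorem mainTheorem3 {𝕜 : Type*} [RCLike 𝕜] {r m d N : ℕ} [NeZero N]
    -- the domain, the operator, and the standing assumptions on them
    (Ω : Set (LSSI.Pt d)) (hΩ : IsOpen Ω)
    (A : LSSI.Coeff 𝕜 r m d) (hA : LSSI.BoundedCoeff Ω A)
    (hself : LSSI.SelfAdjointForm Ω A) (hcoer : LSSI.CoerciveForm Ω A)
    (hcompact : IsCompactOperator (LSSI.toL2 : LSSI.Sob 𝕜 r m Ω → LSSI.L2 𝕜 r Ω))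
    -- the open cover and the partition of unity
    (ω : Fin N → Set (LSSI.Pt d)) (hω : ∀ i, IsOpen (ω i)) (hcover : Ω = ⋃ i, ω i)
    (χ : Fin N → LSSI.Pt d → ℝ) (hχ : LSSI.IsPartition Ω ω χ)
    -- the eigenpairs of the local inverse operators
    (lam : Fin N → ℕ → ℝ) (φ : Fin N → ℕ → LSSI.Sob 𝕜 r m Ω)
    (heig : ∀ i, LSSI.IsEigensystem A (LSSI.localSpace 𝕜 r m Ω (ω i)) (lam i) (φ i))
    -- the subspace iteration, started from nondegenerate initial functions
    (L : Fin N → ℕ) (hL : ∀ i, 1 ≤ L i)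
    (b : (i : Fin N) → ℕ → Fin (L i) → LSSI.Sob 𝕜 r m Ω)
    (hb0 : ∀ i k, b i 0 k ∈ LSSI.localSpace 𝕜 r m Ω (ω i))
    (hrank : ∀ i, LinearIndependent 𝕜 (fun k => LSSI.spectralProj (φ i) (L i) (b i 0 k)))
    (hstep : ∀ i n, LSSI.IterationStep A (LSSI.localSpace 𝕜 r m Ω (ω i)) (b i n) (b i (n + 1))) :
    ∃ (C : ℝ) (ε : ℕ → ℝ), 0 ≤ C ∧ (∀ n, 0 ≤ ε n) ∧ Tendsto ε atTop (𝓝 0) ∧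
      ∀ (f : LSSI.L2 𝕜 r Ω) (u : LSSI.Sob 𝕜 r m Ω), LSSI.Solves A ⊤ u f →
      -- `w i = χ_i u` and `g i = ℒ χ_i u`
      ∀ (w : Fin N → LSSI.Sob 𝕜 r m Ω) (g : Fin N → LSSI.L2 𝕜 r Ω),
      (∀ i, ∀ᵐ x ∂(volume.restrict Ω), LSSI.toL2 (w i) x = ((χ i x : ℝ) : 𝕜) • LSSI.toL2 u x) →
      (∀ i, LSSI.Solves A (LSSI.localSpace 𝕜 r m Ω (ω i)) (w i) (g i)) →
      ∀ (n : ℕ) (uS : LSSI.Sob 𝕜 r m Ω), LSSI.Solves A (LSSI.multiscaleSpace b n) uS f →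
        LSSI.energyNorm A (u - uS) ≤
          Real.sqrt (⨆ i, lam i (L i)) * ∑ i, ‖g i‖ +
            C * ((⨆ i, lam i (L i) / lam i (L i - 1)) + ε n) ^ n * ‖LSSI.toL2 u‖ := by
  have : CompleteSpace (LSSI.Sob 𝕜 r m Ω) :=
    (Submodule.isClosed_topologicalClosure _).completeSpace_coe
  obtain ⟨M, hM⟩ := LSSI.exists_norm_form_le hA
  obtain ⟨α, hα, hαc⟩ := hcoer
  obtain ⟨H, _, _, _, e, he⟩ := LSSI.exists_continuousLinearEquiv_inner_eq_form (LSSI.form A)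
    (LSSI.form_add_left hA) (LSSI.form_smul_left hA) hself hM hα hαc
  have hlam : ∀ i j, 0 < lam i j := fun i => LSSI.eigenvalue_pos (heig i).mem
    (heig i).orthonormal fun j => ((heig i).eigen j).varSolves he
  have happrox := fun i => LSSI.exists_local_approx (ℓ := L i) (b := b i)
    (e := (e : LSSI.Sob 𝕜 r m Ω →ₗ[𝕜] H)) e.injective (heig i).mem (heig i).orthonormal
    (fun j => ((heig i).eigen j).varSolves he) (heig i).antitone
    ((heig i).norm_sq_le he hcompact (LSSI.isClosed_localSpace (hω i)) (L i)) (hb0 i) (hrank i)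
    (fun n k => ⟨(hstep i n k).1, (hstep i n k).2.imp fun μ hμ =>
      ⟨fun v hv => by
        rw [← hμ.1 v hv, ← he]
        rfl, hμ.2⟩⟩)
  choose C hC0 hC using happrox
  choose K hK0 hK using fun i => LSSI.exists_norm_toL2_le (𝕜 := 𝕜) (r := r) (m := m) hΩ hχ i
  -- `C i` comes from the initial eigenfunction errors, `K i` bounds `χ i`. The contraction factor
  -- is exact, so `ε = 0`.
  refine ⟨∑ i, C i * K i, fun _ => 0, Finset.sum_nonneg fun i _ => mul_nonneg (hC0 i) (hK0 i),
    fun _ => le_rfl, tendsto_const_nhds, ?_⟩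
  intro f u hu w g hw hg n uS huS
  choose s hs hsn using fun i => hC i (w i) (g i) ((hg i).varSolves he) n
  rw [LSSI.energyNorm_eq_norm he]
  have hsum : ∑ i, s i ∈ LSSI.multiscaleSpace b n :=
    Submodule.sum_mem _ fun i _ => Submodule.mem_iSup_of_mem i (hs i)
  refine (LSSI.galerkin_norm_le he hu huS hsum).trans ?_
  -- The first rewrite also expands `u` inside `‖LSSI.toL2 u‖`; the reverse one restores it there.
  rw [LSSI.eq_sum_of_isPartition hΩ hχ hw, ← Finset.sum_sub_distrib, map_sum,
    ← LSSI.eq_sum_of_isPartition hΩ hχ hw, Finset.mul_sum, Finset.sum_mul, Finset.sum_mul,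
    ← Finset.sum_add_distrib]
  refine (norm_sum_le _ _).trans (Finset.sum_le_sum fun i _ => (hsn i).trans ?_)
  have h1 : lam i (L i) ≤ ⨆ i, lam i (L i) :=
    le_ciSup (f := fun i => lam i (L i)) (Set.finite_range _).bddAbove i
  have h2 : lam i (L i) / lam i (L i - 1) ≤ ⨆ i, lam i (L i) / lam i (L i - 1) :=
    le_ciSup (f := fun i => lam i (L i) / lam i (L i - 1)) (Set.finite_range _).bddAbove i
  have h3 : 0 ≤ lam i (L i) / lam i (L i - 1) := (div_pos (hlam i _) (hlam i _)).le
  have h4 := hC0 i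
  have h5 := hK0 i
  have h6 : 0 ≤ (⨆ i, lam i (L i) / lam i (L i - 1)) := h3.trans h2
  rw [add_zero]
  refine add_le_add (by gcongr) ?_
  calc C i * (lam i (L i) / lam i (L i - 1)) ^ n * ‖LSSI.toL2 (w i)‖
      ≤ C i * (⨆ i, lam i (L i) / lam i (L i - 1)) ^ n * (K i * ‖LSSI.toL2 u‖) := by
        gcongr
        exact hK i u (w i) (hw i)
    _ = _ := by ring
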